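/- Let $G$ be a finite directed graph without loops or multiple edges, let $\mathcal S=(S_v)_{v\in V(G)}$ be a family of nonempty sets of positive integers, and let $\mathcal A=V(G)$. The $\mathcal S$-graph shift $X(G,\mathcal S)\subseteq\mathcal A^{\mathbb Z}$ is the closure, in the product topology of the discrete topology on $\mathcal A$, of the set of all bi-infinite words $\cdots u_{-1}^{n_{-1}}u_0^{n_0}u_1^{n_1}\cdots$ with $u_i\in V(G)$, $n_i\in S_{u_i}$ and $(u_i,u_{i+1})\in E(G)$ for all $i\in\mathbb Z$. Assume that $X(G,\mathcal S)$ is nonempty (equivalently, $G$ contains a directed cycle). The generating matrix $B(x)$ is the $V(G)\times V(G)$ matrix whose $(i,j)$ entry is $\sum_{s\in S_i}x^s$ if $(i,j)\in E(G)$ and $0$ otherwise. For $x>0$, let $\rho(x)\in[0,\infty]$ be the spectral radius of $B(x)$ if all the series $\sum_{s\in S_v}x^s$, $v\in V(G)$, converge. If one of them diverges, let $\rho(x)=\sup_N\rho_N(x)$, where $\rho_N(x)$ is the spectral radius of the matrix with entries $\sum_{s\in S_i,\,s\le N}x^s$ if $(i,j)\in E(G)$ and $0$ otherwise. Then there is exactly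 one real number $\lambda>0$ with $\rho(\lambda)=1$, and the topological entropy of $X(G,\mathcal S)$ is $$h(X(G,\mathcal S))=\lim_{n\to\infty}\frac1n\log|\mathcal B_n(X(G,\mathcal S))|=\log\lambda^{-1},$$ where $\mathcal B_n(X)$ is the set of words of length $n$ that appear in some point of $X$; in particular this limit exists. -/

import Mathlib

open Filter Topology
open scoped ENNReal

/-- A set-equipped graph `(G, 𝒮)` on the vertex set `V`: a directed graph without loops (a relation
cannot have multiple edges), together with a nonempty set of positive integers at every vertex. -/
structure SetEquippedGraph (V : Type*) extends Digraph V where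
  loopless : ∀ v, ¬ Adj v v
  S : V → Set ℕ
  S_nonempty : ∀ v, (S v).Nonempty
  S_pos : ∀ v, ∀ s ∈ S v, 0 < s

namespace SetEquippedGraph

variable {V : Type*}

/-- The bi-infinite words `⋯ u₋₁^{n₋₁} u₀^{n₀} u₁^{n₁} ⋯` with `nᵢ ∈ S_{uᵢ}` and `(uᵢ, uᵢ₊₁)` an
edge for every `i : ℤ`. The integer `t i` is the position at which the block `uᵢ^{nᵢ}` starts;
since all `nᵢ` are positive, these blocks cover `ℤ`. -/
def blockWords (𝒢 : SetEquippedGraph V) : Set (ℤ → V) :=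
  {x | ∃ (u : ℤ → V) (n : ℤ → ℕ) (t : ℤ → ℤ),
    (∀ i, n i ∈ 𝒢.S (u i)) ∧ (∀ i, 𝒢.Adj (u i) (u (i + 1))) ∧
    (∀ i, t (i + 1) = t i + n i) ∧
    ∀ i k, t i ≤ k → k < t (i + 1) → x k = u i}

theorem blockWords_shift (𝒢 : SetEquippedGraph V) (g : ℤ) :
    Set.MapsTo (SymbolicDynamics.FullShift.shift g) 𝒢.blockWords 𝒢.blockWords := by
  rintro x ⟨u, n, t, hn, hu, ht, hx⟩
  refine ⟨u, n, fun i => t i - g, hn, hu, fun i => ?_, fun i k h1 h2 => ?_⟩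
  · simp only [ht i]; ring
  · exact hx i (g + k) (by dsimp only at h1; linarith) (by dsimp only at h2; linarith)

/-- The `𝒮`-graph shift `X(G, 𝒮)`: the closure of the set of block words in `V^ℤ`
(`V` carries the discrete topology where this is used). -/
def shiftSpace [TopologicalSpace V] (𝒢 : SetEquippedGraph V) :
    SymbolicDynamics.FullShift.Subshift V ℤ where
  carrier := closure 𝒢.blockWords
  isClosed := isClosed_closure
  mapsTo g := (𝒢.blockWords_shift g).closure (SymbolicDynamics.FullShift.continuous_shift g)

end SetEquippedGraph

/-- `𝓑_n(X)`: the words of length `n` that appear in some point of the shift space `X`. -/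
def allowedBlocks {A : Type*} [TopologicalSpace A]
    (X : SymbolicDynamics.FullShift.Subshift A ℤ) (n : ℕ) : Set (Fin n → A) :=
  {w | ∃ x ∈ X.carrier, ∃ m : ℤ, ∀ i : Fin n, w i = x (m + (i : ℕ))}

/-- The topological entropy `lim (1/n) log |𝓑_n(X)|` exists and equals `h`. -/
def HasEntropy {A : Type*} [TopologicalSpace A]
    (X : SymbolicDynamics.FullShift.Subshift A ℤ) (h : ℝ) : Prop :=
  Tendsto (fun n : ℕ => (1 / (n : ℝ)) * Real.log ((allowedBlocks X n).ncard : ℝ)) atTop (𝓝 h)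

/-- The generating function `∑_{s ∈ S} x^s` (used only where it converges). -/
noncomputable def genFun (S : Set ℕ) (x : ℝ) : ℝ := ∑' s : S, x ^ (s : ℕ)

open Classical in
/-- The generating matrix `B(x)` of the graph `G` with the sets `S`. -/
noncomputable def genMatrix {V : Type*} (G : Digraph V) (S : V → Set ℕ) (x : ℝ) : Matrix V V ℝ :=
  Matrix.of fun i j => if G.Adj i j then genFun (S i) x else 0

/-- The spectral radius of a real square matrix: the largest modulus of a complex eigenvalue. -/
noncomputable def matrixSpectralRadius {V : Type*} [Fintype V] [DecidableEq V]
    (M : Matrix V V ℝ) : ℝ≥0∞ :=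
  spectralRadius ℂ (M.map (fun r : ℝ => (r : ℂ)))

open Classical in
/-- The spectral radius `ρ(x)` of the generating matrix `B(x)`, for `x > 0`.
If all the series `∑_{s ∈ S_v} x^s` converge, it is the spectral radius of the real matrix `B(x)`.
Otherwise `B(x)` has infinite generating functions, and `ρ(x) ∈ [0, ∞]` is the (increasing) limit
of the spectral radii of the matrices obtained by truncating every `S_v` to `S_v ∩ [0, N]`. -/
noncomputable def SetEquippedGraph.rho {V : Type*} [Fintype V] [DecidableEq V]
    (𝒢 : SetEquippedGraph V) (x : ℝ) : ℝ≥0∞ :=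
  if ∀ v, Summable (fun s : 𝒢.S v => x ^ (s : ℕ)) then
    matrixSpectralRadius (genMatrix 𝒢.toDigraph 𝒢.S x)
  else
    ⨆ N : ℕ, matrixSpectralRadius (genMatrix 𝒢.toDigraph (fun v => 𝒢.S v ∩ Set.Iic N) x)

/-! Entropy `h` exists by subadditivity, and the solution is `λ = exp (-h)`. Since `G` has no loops,
a word splits uniquely into maximal blocks, so the entries of `B(x)^k` are the weights `∑ x^|w|` of
words made of `k` complete blocks (`genMatrixENNReal_pow_apply`). This compares the growth of
`B(x)^k` with the power series `∑ |𝓑_n| x^n`, whose radius of convergence is `exp (-h)`.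

If `x < exp (-h)`, the series converges and bounds the entries of `B(x)^k` between vertices that
extend to infinite paths; hence truncated radii are at most 1 (`truncRho_le_one`), also in the limit
`x = exp (-h)`. Conversely, an allowed word is a chain of complete blocks between two partial ones,
which costs only a polynomial factor (`ncard_allowedBlocks_mul_pow_le`). If the radius were below 1
at `exp (-h) < 1`, it would stay below 1 slightly to the right, where the series `∑ B^k` converges
and makes `|𝓑_n|` grow too slowly (`exp_mul_le_one`). The case `h = 0` follows from a bi-infinite
path (`one_le_rho_one`). Uniqueness is the scaling `rho_le_div_mul`. -/

section SpectralRadius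

/-! ### Spectral radii of nonnegative matrices through Gelfand's formula -/

variable {V : Type*} [Fintype V]

open scoped Matrix.Norms.Operator in
theorem nnnorm_apply_le_linftyOp (A : Matrix V V ℂ) (i j : V) : ‖A i j‖₊ ≤ ‖A‖₊ := by
  rw [Matrix.linfty_opNNNorm_def]
  refine le_trans ?_ (Finset.le_sup (f := fun i => ∑ j, ‖A i j‖₊) (Finset.mem_univ i))
  exact Finset.single_le_sum (f := fun j => ‖A i j‖₊) (fun _ _ => zero_le) (Finset.mem_univ j)

open scoped Matrix.Norms.Operator in
theorem linftyOp_nnnorm_le_mul {A B : Matrix V V ℂ} {c : NNReal}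
    (h : ∀ i j, ‖A i j‖₊ ≤ c * ‖B i j‖₊) : ‖A‖₊ ≤ c * ‖B‖₊ := by
  rw [Matrix.linfty_opNNNorm_def, Matrix.linfty_opNNNorm_def]
  refine Finset.sup_le fun i hi => ?_
  refine le_trans (Finset.sum_le_sum fun j _ => h i j) ?_
  rw [← Finset.mul_sum]
  exact mul_le_mul_right (Finset.le_sup (f := fun i => ∑ j, ‖B i j‖₊) hi) c

variable [DecidableEq V]

theorem map_ofReal_pow (M : Matrix V V ℝ) (k : ℕ) :
    (M.map (fun r : ℝ => (r : ℂ))) ^ k = (M ^ k).map (fun r : ℝ => (r : ℂ)) :=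
  (map_pow (Complex.ofRealHom.mapMatrix (m := V)) M k).symm

theorem Matrix.pow_apply_le_of_le_smul {M M' : Matrix V V ℝ} {c : ℝ}
    (hM : ∀ i j, 0 ≤ M i j) (h : ∀ i j, M i j ≤ c * M' i j) (k : ℕ) (i j : V) :
    (M ^ k) i j ≤ c ^ k * (M' ^ k) i j := by
  induction k generalizing i j with
  | zero => simp
  | succ k ih =>
    rw [pow_succ, pow_succ, pow_succ, Matrix.mul_apply, Matrix.mul_apply, Finset.mul_sum]
    refine Finset.sum_le_sum fun a _ => ?_
    calc (M ^ k) i a * M a j ≤ (c ^ k * (M' ^ k) i a) * (c * M' a j) :=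
          mul_le_mul (ih i a) (h a j) (hM a j)
            ((Matrix.pow_apply_nonneg hM k i a).trans (ih i a))
      _ = _ := by ring

open scoped Matrix.Norms.Operator

theorem matrixSpectralRadius_tendsto (M : Matrix V V ℝ) :
    Tendsto (fun k : ℕ => ((‖(M ^ k).map (fun r : ℝ => (r : ℂ))‖₊ : ℝ≥0∞) ^ (1 / k : ℝ))) atTop
      (𝓝 (matrixSpectralRadius M)) := by
  have := spectrum.pow_nnnorm_pow_one_div_tendsto_nhds_spectralRadius
    (M.map (fun r : ℝ => (r : ℂ)))
  simpa only [map_ofReal_pow, matrixSpectralRadius] using this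

/-- Entrywise domination passes to powers and then to the row-sum norm, so Gelfand's formula carries
it to the limit. -/
theorem matrixSpectralRadius_le_mul {M M' : Matrix V V ℝ} {c : ℝ} (hc : 0 ≤ c)
    (hM : ∀ i j, 0 ≤ M i j) (h : ∀ i j, M i j ≤ c * M' i j) :
    matrixSpectralRadius M ≤ ENNReal.ofReal c * matrixSpectralRadius M' := by
  refine le_of_tendsto_of_tendsto (matrixSpectralRadius_tendsto M)
    (ENNReal.Tendsto.const_mul (matrixSpectralRadius_tendsto M') (Or.inr ENNReal.ofReal_ne_top)) ?_
  filter_upwards [eventually_ne_atTop 0] with k hk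
  have h1 : ‖(M ^ k).map (fun r : ℝ => (r : ℂ))‖₊ ≤
      c.toNNReal ^ k * ‖(M' ^ k).map (fun r : ℝ => (r : ℂ))‖₊ := by
    refine linftyOp_nnnorm_le_mul fun i j => ?_
    have h2 := Matrix.pow_apply_le_of_le_smul hM h k i j
    rw [← NNReal.coe_le_coe]
    simp only [Matrix.map_apply, coe_nnnorm, Complex.norm_real, NNReal.coe_mul, NNReal.coe_pow,
      Real.coe_toNNReal c hc]
    rw [Real.norm_of_nonneg (Matrix.pow_apply_nonneg hM k i j)]
    exact h2.trans (mul_le_mul_of_nonneg_left (le_abs_self _) (pow_nonneg hc k))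
  have hk' : (0 : ℝ) ≤ 1 / k := by positivity
  calc ((‖(M ^ k).map (fun r : ℝ => (r : ℂ))‖₊ : ℝ≥0∞) ^ (1 / k : ℝ))
      ≤ ((ENNReal.ofReal c) ^ k * (‖(M' ^ k).map (fun r : ℝ => (r : ℂ))‖₊ : ℝ≥0∞)) ^ (1 / k : ℝ) := by
        refine ENNReal.rpow_le_rpow ?_ hk'
        rw [ENNReal.ofReal]
        exact_mod_cast h1
    _ = _ := by
        rw [ENNReal.mul_rpow_of_nonneg _ _ hk', one_div, ENNReal.pow_rpow_inv_natCast hk]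

/-- A radius above 1 would make the norms of the powers grow geometrically. The offset `d` is there
because the bound applied later holds only for large exponents. -/
theorem matrixSpectralRadius_le_one {M : Matrix V V ℝ} {K : ℝ} {d : ℕ}
    (hM : ∀ i j, 0 ≤ M i j) (h : ∀ k i j, (M ^ (k + d)) i j ≤ K) : matrixSpectralRadius M ≤ 1 := by
  by_contra! hlt
  obtain ⟨c, hc1, hc⟩ := ENNReal.lt_iff_exists_nnreal_btwn.1 hlt
  have hc1' : (1 : NNReal) < c := by exact_mod_cast hc1
  have h1 := (matrixSpectralRadius_tendsto M).eventually_const_lt hc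
  obtain ⟨K', hK'⟩ : ∃ K' : NNReal, ∀ k, ‖(M ^ (k + d)).map (fun r : ℝ => (r : ℂ))‖₊ ≤ K' := by
    refine ⟨Real.toNNReal K * ‖(Matrix.of fun _ _ => 1 : Matrix V V ℂ)‖₊, fun k => ?_⟩
    refine linftyOp_nnnorm_le_mul fun i j => ?_
    rw [← NNReal.coe_le_coe]
    simp only [Matrix.map_apply, coe_nnnorm, Complex.norm_real, Matrix.of_apply,
      nnnorm_one, mul_one]
    rw [Real.norm_of_nonneg (Matrix.pow_apply_nonneg hM _ i j)]
    exact (h k i j).trans (Real.le_coe_toNNReal K)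
  have h2 : Tendsto (fun k : ℕ => c ^ k) atTop atTop := tendsto_pow_atTop_atTop_of_one_lt hc1'
  obtain ⟨k, hk1, hk2, hk3, hk4⟩ := (h1.and ((h2.eventually_gt_atTop K').and
    ((eventually_ge_atTop d).and (eventually_ne_atTop 0)))).exists
  obtain ⟨m, rfl⟩ := Nat.exists_eq_add_of_le' hk3
  have h3 : (c : ℝ≥0∞) ^ (m + d) ≤ ‖(M ^ (m + d)).map (fun r : ℝ => (r : ℂ))‖₊ := by
    have := pow_le_pow_left₀ zero_le hk1.le (m + d)
    rwa [one_div, ENNReal.rpow_inv_natCast_pow hk4] at this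
  exact absurd (hk2.trans_le ((by exact_mod_cast h3 : c ^ (m + d) ≤ _).trans (hK' m))) (lt_irrefl _)

theorem one_le_matrixSpectralRadius {M : Matrix V V ℝ} (h : ∀ k, ∃ i j, 1 ≤ (M ^ k) i j) :
    1 ≤ matrixSpectralRadius M := by
  refine ge_of_tendsto' (matrixSpectralRadius_tendsto M) fun k => ?_
  obtain ⟨i, j, hij⟩ := h k
  have h1 : (1 : NNReal) ≤ ‖(M ^ k).map (fun r : ℝ => (r : ℂ))‖₊ := by
    refine le_trans ?_ (nnnorm_apply_le_linftyOp _ i j)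
    rw [← NNReal.coe_le_coe]
    simpa using hij.trans (le_abs_self _)
  have h2 := ENNReal.rpow_le_rpow (ENNReal.coe_le_coe.2 h1) (by positivity : (0 : ℝ) ≤ 1 / k)
  simpa using h2

theorem tsum_pow_ne_top_of_matrixSpectralRadius_lt_one {M : Matrix V V ℝ}
    (h : matrixSpectralRadius M < 1) (i j : V) :
    ∑' k : ℕ, ENNReal.ofReal ((M ^ k) i j) ≠ ∞ := by
  obtain ⟨c, hc, hc1⟩ := ENNReal.lt_iff_exists_nnreal_btwn.1 h
  have hc1' : c < 1 := by exact_mod_cast hc1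
  have h1 := (matrixSpectralRadius_tendsto M).eventually_lt_const hc
  have h2 : Summable fun k => ‖(M ^ k) i j‖ := by
    refine summable_of_isBigO_nat (summable_geometric_of_lt_one c.2 hc1') ?_
    refine Asymptotics.IsBigO.of_bound 1 ?_
    filter_upwards [h1, eventually_ne_atTop 0] with k hk hk0
    have h3 : (‖(M ^ k).map (fun r : ℝ => (r : ℂ))‖₊ : ℝ≥0∞) ≤ (c : ℝ≥0∞) ^ k := by
      have := pow_le_pow_left₀ zero_le hk.le k
      rwa [one_div, ENNReal.rpow_inv_natCast_pow hk0] at this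
    have h4 : ‖(M ^ k).map (fun r : ℝ => (r : ℂ))‖₊ ≤ c ^ k := by exact_mod_cast h3
    have h5 := (nnnorm_apply_le_linftyOp _ i j).trans h4
    rw [← NNReal.coe_le_coe] at h5
    simpa using h5
  exact (Summable.of_norm h2).tsum_ofReal_ne_top

end SpectralRadius

/-! ### Long walks and infinite rays -/

section Walks

variable {V : Type*}

/-- There is a walk of length `k` from `v` along the relation `R`. -/
def HasWalk (R : V → V → Prop) : ℕ → V → Prop
  | 0, _ => True
  | k + 1, v => ∃ u, R v u ∧ HasWalk R k u

theorem HasWalk.of_succ {R : V → V → Prop} {k : ℕ} {v : V} (h : HasWalk R (k + 1) v) :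
    HasWalk R k v := by
  induction k generalizing v with
  | zero => trivial
  | succ k ih =>
    obtain ⟨u, hu, h⟩ := h
    exact ⟨u, hu, ih h⟩

theorem HasWalk.mono {R : V → V → Prop} {k l : ℕ} {v : V} (h : HasWalk R l v) (hkl : k ≤ l) :
    HasWalk R k v := by
  induction l, hkl using Nat.le_induction with
  | base => exact h
  | succ l _ ih => exact ih h.of_succ

/-- By finiteness one length `d` serves every vertex: a walk of length `d` forces walks of all
lengths. Such a vertex has a successor of the same kind, and iterating the choice gives the ray. -/
theorem exists_length_forcing_ray [Finite V] (R : V → V → Prop) :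
    ∃ d, ∀ v, HasWalk R d v → ∃ f : ℕ → V, f 0 = v ∧ ∀ n, R (f n) (f (n + 1)) := by
  have h1 : ∀ v, ∃ d, HasWalk R d v → ∀ k, HasWalk R k v := by
    intro v
    by_cases h : ∀ k, HasWalk R k v
    · exact ⟨0, fun _ => h⟩
    · push Not at h
      obtain ⟨d, hd⟩ := h
      exact ⟨d, fun h => absurd h hd⟩
  choose D hD using h1
  obtain ⟨d, hd⟩ := (Set.finite_range D).bddAbove
  have h2 : ∀ v, HasWalk R d v → ∀ k, HasWalk R k v :=
    fun v hv => hD v (hv.mono (hd ⟨v, rfl⟩))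
  have h3 : ∀ v : {v // ∀ k, HasWalk R k v}, ∃ u : {v // ∀ k, HasWalk R k v}, R v u := by
    rintro ⟨v, hv⟩
    -- One step more than `d`, so that the successor still starts a walk of length `d`.
    obtain ⟨u, hu, hw⟩ := hv (d + 1)
    exact ⟨⟨u, h2 u hw⟩, hu⟩
  choose g hg using h3
  refine ⟨d, fun v hv => ⟨fun n => (g^[n] ⟨v, h2 v hv⟩ : V), rfl, fun n => ?_⟩⟩
  simp only [Function.iterate_succ_apply']
  exact hg _

end Walks

/-! ### Block paths and powers of the generating matrix -/

namespace SetEquippedGraph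

variable {V : Type*}

/-- The words made of `k` complete blocks, the first at the vertex `i`, such that `j` is an
admissible vertex of the block that follows (`j = i` if `k = 0`). -/
def blockPaths (𝒢 : SetEquippedGraph V) : ℕ → V → V → Set (List V)
  | 0, i, j => {w | w = [] ∧ i = j}
  | k + 1, i, j => {w | ∃ u, 𝒢.Adj i u ∧ ∃ s ∈ 𝒢.S i, ∃ w' ∈ blockPaths 𝒢 k u j,
      w = List.replicate s i ++ w'}

theorem head?_of_mem_blockPaths_succ {𝒢 : SetEquippedGraph V} {k : ℕ} {i j : V} {w : List V}
    (hw : w ∈ 𝒢.blockPaths (k + 1) i j) : w.head? = some i := by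
  obtain ⟨u, -, s, hs, w', -, rfl⟩ := hw
  obtain ⟨s, rfl⟩ := Nat.exists_eq_succ_of_ne_zero (𝒢.S_pos i s hs).ne'
  simp [List.replicate_succ]

/-- Looplessness enters here: the letter changes at each block boundary, so the boundaries can be
read off the word. -/
theorem head?_ne_of_mem_blockPaths {𝒢 : SetEquippedGraph V} {k : ℕ} {i u j : V} {w : List V}
    (hu : 𝒢.Adj i u) (hw : w ∈ 𝒢.blockPaths k u j) : w.head? ≠ some i := by
  cases k with
  | zero => rw [hw.1]; simp
  | succ k =>
    rw [head?_of_mem_blockPaths_succ hw]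
    rintro ⟨⟩
    exact 𝒢.loopless _ hu

theorem blockPaths_left_unique {𝒢 : SetEquippedGraph V} {k : ℕ} {u u' j : V} {w : List V}
    (h : w ∈ 𝒢.blockPaths k u j) (h' : w ∈ 𝒢.blockPaths k u' j) : u = u' := by
  cases k with
  | zero => exact h.2.trans h'.2.symm
  | succ k =>
    exact Option.some.inj
      ((head?_of_mem_blockPaths_succ h).symm.trans (head?_of_mem_blockPaths_succ h'))

theorem replicate_append_inj_of_head?_ne {a : V} {s t : ℕ} {w v : List V}
    (hw : w.head? ≠ some a) (hv : v.head? ≠ some a)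
    (h : List.replicate s a ++ w = List.replicate t a ++ v) : s = t ∧ w = v := by
  induction s generalizing t with
  | zero =>
    cases t with
    | zero => exact ⟨rfl, by simpa using h⟩
    | succ t => exact absurd (by simpa [List.replicate_succ] using congrArg List.head? h) hw
  | succ s ih =>
    cases t with
    | zero => exact absurd (by simpa [List.replicate_succ] using (congrArg List.head? h).symm) hv
    | succ t =>
      obtain ⟨h1, h2⟩ := ih (t := t) (by simpa [List.replicate_succ] using h)
      exact ⟨by rw [h1], h2⟩

/-- Prepending a block at the vertex `i`. -/
def consBlock (𝒢 : SetEquippedGraph V) (k : ℕ) (i j : V)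
    (p : Σ u : {u | 𝒢.Adj i u}, 𝒢.S i × 𝒢.blockPaths k u j) : 𝒢.blockPaths (k + 1) i j :=
  ⟨List.replicate (p.2.1 : ℕ) i ++ (p.2.2 : List V),
    p.1, p.1.2, p.2.1, p.2.1.2, p.2.2, p.2.2.2, rfl⟩

theorem consBlock_bijective (𝒢 : SetEquippedGraph V) (k : ℕ) (i j : V) :
    Function.Bijective (𝒢.consBlock k i j) := by
  constructor
  · rintro ⟨⟨u, hu⟩, ⟨s, hs⟩, ⟨w, hw⟩⟩ ⟨⟨u', hu'⟩, ⟨s', hs'⟩, ⟨w', hw'⟩⟩ h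
    obtain ⟨rfl, rfl⟩ := replicate_append_inj_of_head?_ne (head?_ne_of_mem_blockPaths hu hw)
      (head?_ne_of_mem_blockPaths hu' hw') (congrArg Subtype.val h)
    obtain rfl := blockPaths_left_unique hw hw'
    rfl
  · rintro ⟨_, u, hu, s, hs, w, hw, rfl⟩
    exact ⟨⟨⟨u, hu⟩, ⟨s, hs⟩, ⟨w, hw⟩⟩, rfl⟩

open Classical in
/-- The generating matrix with entries in `[0, ∞]`. -/
noncomputable def genMatrixENNReal (𝒢 : SetEquippedGraph V) (x : ℝ≥0∞) : Matrix V V ℝ≥0∞ :=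
  Matrix.of fun i j => if 𝒢.Adj i j then ∑' s : 𝒢.S i, x ^ (s : ℕ) else 0

/-- Multiplying by the matrix on the left prepends a block, and `consBlock_bijective` excludes
double counting. Values in `[0, ∞]` avoid all convergence conditions. -/
theorem genMatrixENNReal_pow_apply [Fintype V] [DecidableEq V] (𝒢 : SetEquippedGraph V)
    (x : ℝ≥0∞) (k : ℕ) (i j : V) :
    (𝒢.genMatrixENNReal x ^ k) i j = ∑' w : 𝒢.blockPaths k i j, x ^ (w : List V).length := by
  induction k generalizing i j with
  | zero =>
    rw [pow_zero, Matrix.one_apply]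
    by_cases h : i = j
    · have h1 : 𝒢.blockPaths 0 i j = {[]} := by ext w; simp [blockPaths, h]
      rw [h1, if_pos h, tsum_singleton ([] : List V) fun w : List V => x ^ w.length]
      simp
    · have h1 : 𝒢.blockPaths 0 i j = ∅ := by ext w; simp [blockPaths, h]
      rw [h1, if_neg h, tsum_empty]
  | succ k ih =>
    rw [← (Equiv.ofBijective _ (𝒢.consBlock_bijective k i j)).tsum_eq
      fun w : 𝒢.blockPaths (k + 1) i j => x ^ (w : List V).length, ENNReal.tsum_sigma', pow_succ',
      Matrix.mul_apply, ← tsum_fintype (L := SummationFilter.unconditional _)]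
    refine Eq.trans (tsum_congr fun u => ?_)
      (tsum_subtype {u | 𝒢.Adj i u} fun u => ∑' b : 𝒢.S i × 𝒢.blockPaths k u j,
        x ^ (List.replicate (b.1 : ℕ) i ++ (b.2 : List V)).length).symm
    by_cases hu : 𝒢.Adj i u
    · rw [Set.indicator_of_mem (by exact hu), ENNReal.tsum_prod', ih]
      simp only [genMatrixENNReal, Matrix.of_apply, if_pos hu, List.length_append,
        List.length_replicate, pow_add, ENNReal.tsum_mul_left, ENNReal.tsum_mul_right]
    · rw [Set.indicator_of_notMem (by exact hu)]
      simp [genMatrixENNReal, hu]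

theorem exists_blockStarts (n : ℤ → ℕ) : ∃ t : ℤ → ℤ, (∀ i, t (i + 1) = t i + n i) ∧
    ∀ m : ℕ, t m = ∑ q ∈ Finset.range m, n q := by
  refine ⟨fun i => match i with
    | Int.ofNat m => ∑ q ∈ Finset.range m, (n q : ℤ)
    | Int.negSucc m => -∑ q ∈ Finset.range (m + 1), (n (-(q + 1)) : ℤ), fun i => ?_, fun m => ?_⟩
  · rcases i with m | m
    · exact Finset.sum_range_succ (fun q : ℕ => (n q : ℤ)) m
    · rcases m with _ | m
      · change (∑ q ∈ Finset.range 0, (n q : ℤ)) = _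
        simp
      · change (-∑ q ∈ Finset.range (m + 1), (n (-(q + 1)) : ℤ)) = _
        simp only
        rw [Finset.sum_range_succ _ (m + 1), Int.negSucc_eq]
        push_cast
        ring
  · push_cast
    rfl

theorem exists_mem_blockWords {𝒢 : SetEquippedGraph V} {u : ℤ → V} {n : ℤ → ℕ}
    (hn : ∀ i, n i ∈ 𝒢.S (u i)) (hu : ∀ i, 𝒢.Adj (u i) (u (i + 1))) :
    ∃ x ∈ 𝒢.blockWords, ∀ m p : ℕ, ∑ q ∈ Finset.range m, n q ≤ p →
      p < ∑ q ∈ Finset.range (m + 1), n q → x p = u m := by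
  classical
  obtain ⟨t, ht, ht'⟩ := exists_blockStarts n
  have hmono : StrictMono t := strictMono_int_of_lt_succ fun i => by
    have := 𝒢.S_pos _ _ (hn i)
    rw [ht]; omega
  let x : ℤ → V := fun k => if h : ∃ i, t i ≤ k ∧ k < t (i + 1) then u h.choose else u 0
  have hx : ∀ i k, t i ≤ k → k < t (i + 1) → x k = u i := by
    intro i k h1 h2
    have h : ∃ i, t i ≤ k ∧ k < t (i + 1) := ⟨i, h1, h2⟩
    have h3 : h.choose = i := by
      have := hmono.lt_iff_lt.1 (h.choose_spec.1.trans_lt h2)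
      have := hmono.lt_iff_lt.1 (h1.trans_lt h.choose_spec.2)
      omega
    simp only [x, dif_pos h, h3]
  refine ⟨x, ⟨u, n, t, hn, hu, ht, hx⟩, fun m p h1 h2 => hx m p ?_ ?_⟩
  · rw [ht' m]; exact_mod_cast h1
  · have := ht' (m + 1)
    push_cast at this
    rw [this]; exact_mod_cast h2

theorem exists_ray_of_mem_blockPaths {𝒢 : SetEquippedGraph V} {k : ℕ} {i j : V} {w : List V}
    (hw : w ∈ 𝒢.blockPaths k i j) {f : ℕ → V} (hf0 : f 0 = j)
    (hf : ∀ m, 𝒢.Adj (f m) (f (m + 1))) :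
    ∃ (u : ℕ → V) (n : ℕ → ℕ), u 0 = i ∧ (∀ m, 𝒢.Adj (u m) (u (m + 1))) ∧
      (∀ m, n m ∈ 𝒢.S (u m)) ∧ w.length ≤ ∑ q ∈ Finset.range k, n q ∧
      ∀ m p v, w[p]? = some v → ∑ q ∈ Finset.range m, n q ≤ p →
        p < ∑ q ∈ Finset.range (m + 1), n q → v = u m := by
  induction k generalizing i w with
  | zero =>
    obtain ⟨rfl, rfl⟩ := hw
    exact ⟨f, fun m => (𝒢.S_nonempty (f m)).choose, hf0, hf,
      fun m => (𝒢.S_nonempty (f m)).choose_spec, by simp, by simp⟩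
  | succ k ih =>
    obtain ⟨u₁, hu₁, s, hs, w', hw', rfl⟩ := hw
    obtain ⟨u, n, hu0, hu, hn, hlen, hpos⟩ := ih hw'
    refine ⟨fun m => Nat.casesOn m i u, fun m => Nat.casesOn m s n, rfl, ?_, ?_, ?_, ?_⟩
    · rintro (_ | m)
      · simpa [hu0] using hu₁
      · exact hu m
    · rintro (_ | m)
      · exact hs
      · exact hn m
    · rw [Finset.sum_range_succ']
      simpa [add_comm] using hlen
    · intro m p v hv h1 h2
      rw [Finset.sum_range_succ'] at h2
      rcases m with _ | m
      · have h2 : p < s := by simpa using h2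
        rw [List.getElem?_append_left (by simpa using h2)] at hv
        simpa [List.getElem?_replicate, h2] using hv.symm
      · rw [Finset.sum_range_succ'] at h1
        change ∑ q ∈ Finset.range m, n q + s ≤ p at h1
        change p < ∑ q ∈ Finset.range (m + 1), n q + s at h2
        rw [List.getElem?_append_right (by simp; omega), List.length_replicate] at hv
        exact hpos m (p - s) v hv (by omega) (by omega)

/-- The ray `f` continues the path to the right and the backward ray `g` to the left, with arbitrary
admissible block lengths. Thus a block path is an allowed word as soon as its end vertices carry
such rays. -/
theorem exists_mem_blockWords_extending {𝒢 : SetEquippedGraph V} {k : ℕ} {i j : V} {w : List V}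
    (hw : w ∈ 𝒢.blockPaths k i j) {f g : ℕ → V} (hf0 : f 0 = j)
    (hf : ∀ m, 𝒢.Adj (f m) (f (m + 1))) (hg0 : g 0 = i) (hg : ∀ m, 𝒢.Adj (g (m + 1)) (g m)) :
    ∃ x ∈ 𝒢.blockWords, ∀ p : Fin w.length, x (p : ℕ) = w.get p := by
  obtain ⟨u, n, hu0, hu, hn, hlen, hpos⟩ := exists_ray_of_mem_blockPaths hw hf0 hf
  let U : ℤ → V := fun q => match q with
    | Int.ofNat m => u m
    | Int.negSucc m => g (m + 1)
  let N : ℤ → ℕ := fun q => match q with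
    | Int.ofNat m => n m
    | Int.negSucc m => (𝒢.S_nonempty (g (m + 1))).choose
  obtain ⟨x, hx, hxp⟩ := exists_mem_blockWords (𝒢 := 𝒢) (u := U) (n := N)
    (by
      rintro (m | m)
      · exact hn m
      · exact (𝒢.S_nonempty (g (m + 1))).choose_spec)
    (by
      rintro (m | m)
      · exact hu m
      · rcases m with _ | m
        · change 𝒢.Adj (g 1) (u 0)
          rw [hu0, ← hg0]
          exact hg 0
        · exact hg (m + 1))
  refine ⟨x, hx, fun p => ?_⟩
  have hsum : ∀ m, ∑ q ∈ Finset.range m, N q = ∑ q ∈ Finset.range m, n q := fun m => rfl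
  have hex : ∃ m, (p : ℕ) < ∑ q ∈ Finset.range m, n q := ⟨k, p.2.trans_le hlen⟩
  classical
  -- The block `m` containing position `p` precedes the first index whose partial sum exceeds `p`.
  obtain ⟨m, hm⟩ : ∃ m, Nat.find hex = m + 1 := by
    refine Nat.exists_eq_succ_of_ne_zero fun h => ?_
    have := Nat.find_spec hex
    rw [h] at this
    simp at this
  have h1 : (p : ℕ) < ∑ q ∈ Finset.range (m + 1), n q := hm ▸ Nat.find_spec hex
  have h2 : ∑ q ∈ Finset.range m, n q ≤ p := not_lt.1 (Nat.find_min hex (by omega))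
  rw [hxp m p h2 h1]
  exact (hpos m p (w.get p) (by simp) h2 h1).symm

end SetEquippedGraph

/-! ### Existence of the entropy -/

theorem allowedBlocks_ncard_add_le {A : Type*} [Finite A] [TopologicalSpace A]
    (X : SymbolicDynamics.FullShift.Subshift A ℤ) (m n : ℕ) :
    (allowedBlocks X (m + n)).ncard ≤ (allowedBlocks X m).ncard * (allowedBlocks X n).ncard := by
  rw [← Set.ncard_prod]
  refine Set.ncard_le_ncard_of_injOn
    (fun w => (fun i => w (Fin.castAdd n i), fun i => w (Fin.natAdd m i))) ?_ ?_ (Set.toFinite _)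
  · rintro w ⟨x, hx, c, hw⟩
    refine ⟨⟨x, hx, c, fun i => hw _⟩, ⟨x, hx, c + m, fun i => ?_⟩⟩
    change w (Fin.natAdd m i) = _
    rw [hw]
    simp [add_assoc]
  · intro w _ v _ h
    simp only [Prod.mk.injEq] at h
    funext i
    refine Fin.addCases (fun i => congrFun h.1 i) (fun i => congrFun h.2 i) i

/-- Fekete's lemma. The limit is also an infimum, which gives the lower bound for every `n`. -/
theorem exists_hasEntropy {A : Type*} [Finite A] [TopologicalSpace A]
    (X : SymbolicDynamics.FullShift.Subshift A ℤ) (hX : X.carrier.Nonempty) :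
    ∃ h : ℝ, 0 ≤ h ∧ HasEntropy X h ∧
      ∀ n : ℕ, Real.exp h ^ n ≤ ((allowedBlocks X n).ncard : ℝ) := by
  have hpos : ∀ n, 0 < (allowedBlocks X n).ncard := by
    intro n
    obtain ⟨x, hx⟩ := hX
    exact (Set.ncard_pos (Set.toFinite _)).2 ⟨fun i => x (0 + (i : ℕ)), x, hx, 0, fun i => rfl⟩
  have hsub : Subadditive fun n => Real.log ((allowedBlocks X n).ncard : ℝ) := by
    intro m n
    have hm : ((allowedBlocks X m).ncard : ℝ) ≠ 0 := by exact_mod_cast (hpos m).ne'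
    have hn : ((allowedBlocks X n).ncard : ℝ) ≠ 0 := by exact_mod_cast (hpos n).ne'
    rw [← Real.log_mul hm hn]
    exact Real.log_le_log (by exact_mod_cast hpos _)
      (by exact_mod_cast allowedBlocks_ncard_add_le X m n)
  have h0 : ∀ n : ℕ, 0 ≤ Real.log ((allowedBlocks X n).ncard : ℝ) / n :=
    fun n => div_nonneg (Real.log_natCast_nonneg _) n.cast_nonneg
  have hbdd : BddBelow (Set.range fun n : ℕ => Real.log ((allowedBlocks X n).ncard : ℝ) / n) :=
    ⟨0, by rintro _ ⟨n, rfl⟩; exact h0 n⟩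
  have hlim := hsub.tendsto_lim hbdd
  refine ⟨hsub.lim, ge_of_tendsto' hlim h0, ?_, fun n => ?_⟩
  · simpa only [HasEntropy, one_div_mul_eq_div] using hlim
  · rcases eq_or_ne n 0 with rfl | hn
    · rw [pow_zero]; exact_mod_cast hpos 0
    · rw [← Real.exp_nat_mul, ← Real.le_log_iff_exp_le (by exact_mod_cast hpos n), mul_comm]
      have hn' : (0 : ℝ) < n := by exact_mod_cast Nat.pos_of_ne_zero hn
      exact (le_div_iff₀ hn').1 (hsub.lim_le_div hbdd hn)

/-! ### Allowed words against block paths -/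

namespace SetEquippedGraph

variable {V : Type*} {𝒢 : SetEquippedGraph V}

/-- Cylinders are open, so taking the closure adds no finite words. -/
theorem mem_allowedBlocks_iff [TopologicalSpace V] [DiscreteTopology V] {n : ℕ} {w : Fin n → V} :
    w ∈ allowedBlocks 𝒢.shiftSpace n ↔
      ∃ x ∈ 𝒢.blockWords, ∃ m : ℤ, ∀ i : Fin n, w i = x (m + (i : ℕ)) := by
  constructor
  · rintro ⟨x, hx, m, hw⟩
    have hopen : IsOpen (⋂ i : Fin n, (fun y : ℤ → V => y (m + (i : ℕ))) ⁻¹' {w i}) :=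
      isOpen_iInter_of_finite fun i => (isOpen_discrete _).preimage (continuous_apply _)
    obtain ⟨y, hy, hyB⟩ := mem_closure_iff.1 hx _ hopen (Set.mem_iInter.2 fun i => (hw i).symm)
    exact ⟨y, hyB, m, fun i => (Set.mem_iInter.1 hy i).symm⟩
  · rintro ⟨x, hx, m, hw⟩
    exact ⟨x, subset_closure hx, m, hw⟩

theorem map_range_add (x : ℤ → V) (c : ℤ) (a b : ℕ) :
    (List.range (a + b)).map (fun p : ℕ => x (c + p)) =
      (List.range a).map (fun p : ℕ => x (c + p)) ++
        (List.range b).map (fun p : ℕ => x (c + a + p)) := by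
  rw [List.range_add, List.map_append, List.map_map]
  congr 2
  funext p
  simp [add_assoc]

theorem map_range_eq_replicate {x : ℤ → V} {c : ℤ} {N : ℕ} {v : V}
    (h : ∀ p : ℕ, p < N → x (c + p) = v) :
    (List.range N).map (fun p : ℕ => x (c + p)) = List.replicate N v := by
  rw [List.eq_replicate_iff]
  refine ⟨by simp, fun b hb => ?_⟩
  obtain ⟨p, hp, rfl⟩ := List.mem_map.1 hb
  exact h p (List.mem_range.1 hp)

theorem exists_blockPath_from_start {x u : ℤ → V} {n : ℤ → ℕ} {t : ℤ → ℤ}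
    (hn : ∀ i, n i ∈ 𝒢.S (u i)) (hu : ∀ i, 𝒢.Adj (u i) (u (i + 1)))
    (ht : ∀ i, t (i + 1) = t i + n i) (hx : ∀ i k, t i ≤ k → k < t (i + 1) → x k = u i)
    (N : ℕ) (a : ℤ) :
    ∃ k j, ∃ w ∈ 𝒢.blockPaths k (u a) j, ∃ q ≤ N,
      (List.range N).map (fun p : ℕ => x (t a + p)) = w ++ List.replicate q j := by
  induction N using Nat.strong_induction_on generalizing a with
  | _ N ih =>
    by_cases hN : N < n a
    · refine ⟨0, u a, [], ⟨rfl, rfl⟩, N, le_rfl, ?_⟩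
      rw [List.nil_append]
      exact map_range_eq_replicate fun p hp => hx a _ (by omega) (by rw [ht]; omega)
    · obtain ⟨N', rfl⟩ := Nat.exists_eq_add_of_le (not_lt.1 hN)
      have hpos := 𝒢.S_pos _ _ (hn a)
      obtain ⟨k, j, w, hw, q, hq, h⟩ := ih N' (by omega) (a + 1)
      refine ⟨k + 1, j, List.replicate (n a) (u a) ++ w,
        ⟨u (a + 1), hu a, n a, hn a, w, hw, rfl⟩, q, by omega, ?_⟩
      rw [map_range_add, List.append_assoc, ← h, ht,
        map_range_eq_replicate fun p hp => hx a _ (by omega) (by rw [ht]; omega)]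

theorem exists_blockPath_of_mem_blockWords {x : ℤ → V} (hxB : x ∈ 𝒢.blockWords) (N : ℕ) (m : ℤ) :
    ∃ p ≤ N, ∃ i, ∃ q ≤ N, ∃ j, ∃ k i', ∃ w ∈ 𝒢.blockPaths k i' j,
      (List.range N).map (fun p : ℕ => x (m + p)) =
        List.replicate p i ++ (w ++ List.replicate q j) := by
  obtain ⟨u, n, t, hn, hu, ht, hx⟩ := hxB
  -- Blocks have length at least 1, so `t` is unbounded in both directions and some block contains
  -- `m`.
  have hmono : Monotone fun i => t i - i := monotone_int_of_le_succ fun i => by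
    have := 𝒢.S_pos _ _ (hn i)
    simp only [ht]
    omega
  obtain ⟨a, ha, hmax⟩ : ∃ a, t a ≤ m ∧ ∀ z, t z ≤ m → z ≤ a := by
    refine Int.exists_greatest_of_bdd (P := fun a => t a ≤ m) ⟨max 0 (m - t 0), fun z hz => ?_⟩
      ⟨min 0 (m - t 0), ?_⟩
    · rcases le_total z 0 with h | h
      · exact h.trans (le_max_left _ _)
      · have := hmono h
        simp only at this
        exact le_trans (by omega) (le_max_right _ _)
    · have := hmono (min_le_left 0 (m - t 0))
      have := min_le_right 0 (m - t 0)
      simp only at *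
      omega
  have ha' : m < t (a + 1) := by
    by_contra! h
    have := hmax _ h
    omega
  by_cases hN : N ≤ (t (a + 1) - m).toNat
  · refine ⟨N, le_rfl, u a, 0, zero_le, u a, 0, u a, [], ⟨rfl, rfl⟩, ?_⟩
    rw [map_range_eq_replicate fun p hp => hx a _ (by omega) (by omega)]
    simp
  · obtain ⟨N', rfl⟩ := Nat.exists_eq_add_of_le (not_le.1 hN).le
    obtain ⟨k, j, w, hw, q, hq, h⟩ := exists_blockPath_from_start hn hu ht hx N' (a + 1)
    refine ⟨(t (a + 1) - m).toNat, by omega, u a, q, by omega, j, k, _, w, hw, ?_⟩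
    rw [map_range_add, map_range_eq_replicate fun p hp => hx a _ (by omega) (by omega), ← h]
    congr 3
    funext p
    congr 2
    omega

/-- A word is determined by its complete blocks and the partial block at each end; each partial
block has at most `(n + 1) * |V|` choices. As `x ≤ 1`, shortening to the complete blocks only
increases the weight. -/
theorem ncard_allowedBlocks_mul_pow_le [Fintype V] [DecidableEq V] [TopologicalSpace V]
    [DiscreteTopology V] {x : ℝ≥0∞} (hx : x ≤ 1) (n : ℕ) :
    ((allowedBlocks 𝒢.shiftSpace n).ncard : ℝ≥0∞) * x ^ n ≤
      (((n + 1) * Fintype.card V) ^ 2 : ℕ) *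
        ∑ i, ∑ j, ∑' k : ℕ, (𝒢.genMatrixENNReal x ^ k) i j := by
  let P : Set (List V) := ⋃ c : V × V × ℕ, 𝒢.blockPaths c.2.2 c.1 c.2.1
  have hP : ∑' w : P, x ^ (w : List V).length ≤
      ∑ i, ∑ j, ∑' k : ℕ, (𝒢.genMatrixENNReal x ^ k) i j := by
    refine (ENNReal.tsum_iUnion_le_tsum (fun w : List V => x ^ w.length) _).trans_eq ?_
    simp only [ENNReal.tsum_prod', tsum_fintype, genMatrixENNReal_pow_apply]
  have hdec : ∀ w : allowedBlocks 𝒢.shiftSpace n,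
      ∃ c : (Fin (n + 1) × V) × (Fin (n + 1) × V) × P,
        List.ofFn (w : Fin n → V) = List.replicate (c.1.1 : ℕ) c.1.2 ++
          ((c.2.2 : List V) ++ List.replicate (c.2.1.1 : ℕ) c.2.1.2) := by
    rintro ⟨w, hw⟩
    obtain ⟨y, hy, m, hwy⟩ := mem_allowedBlocks_iff.1 hw
    obtain ⟨p, hp, i, q, hq, j, k, i', v, hv, h⟩ := exists_blockPath_of_mem_blockWords hy n m
    refine ⟨((⟨p, by omega⟩, i), (⟨q, by omega⟩, j),
      ⟨v, Set.mem_iUnion.2 ⟨(i', j, k), hv⟩⟩), ?_⟩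
    simp only
    rw [← h]
    exact List.ext_getElem (by simp) (by simp [hwy])
  choose φ hφ using hdec
  have hinj : Function.Injective φ := fun w v h => by
    refine Subtype.ext (List.ofFn_injective ?_)
    rw [hφ, hφ, h]
  have hlen : ∀ w, ((φ w).2.2 : List V).length ≤ n := fun w => by
    have := congrArg List.length (hφ w)
    simp only [List.length_ofFn, List.length_append] at this
    omega
  calc ((allowedBlocks 𝒢.shiftSpace n).ncard : ℝ≥0∞) * x ^ n
      = ∑' _ : allowedBlocks 𝒢.shiftSpace n, x ^ n := by
        rw [ENNReal.tsum_set_const, ← (Set.toFinite _).cast_ncard_eq, ENat.toENNReal_coe]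
    _ ≤ ∑' w, x ^ ((φ w).2.2 : List V).length :=
        ENNReal.tsum_le_tsum fun w => pow_le_pow_right_of_le_one' hx (hlen w)
    _ ≤ ∑' c : (Fin (n + 1) × V) × (Fin (n + 1) × V) × P, x ^ (c.2.2 : List V).length :=
        ENNReal.tsum_comp_le_tsum_of_injective hinj fun c => x ^ (c.2.2 : List V).length
    _ = (((n + 1) * Fintype.card V) ^ 2 : ℕ) * ∑' w : P, x ^ (w : List V).length := by
        simp only [ENNReal.tsum_prod', tsum_fintype, Finset.sum_const, Finset.card_univ,
          Fintype.card_prod, Fintype.card_fin, nsmul_eq_mul]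
        push_cast
        ring
    _ ≤ _ := by gcongr

theorem genMatrixENNReal_pow_apply_le [Fintype V] [DecidableEq V] [TopologicalSpace V]
    [DiscreteTopology V] (x : ℝ≥0∞) (k : ℕ) {i j : V} {f g : ℕ → V} (hf0 : f 0 = j)
    (hf : ∀ m, 𝒢.Adj (f m) (f (m + 1))) (hg0 : g 0 = i) (hg : ∀ m, 𝒢.Adj (g (m + 1)) (g m)) :
    (𝒢.genMatrixENNReal x ^ k) i j ≤
      ∑' n : ℕ, ((allowedBlocks 𝒢.shiftSpace n).ncard : ℝ≥0∞) * x ^ n := by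
  have hmem : ∀ w : 𝒢.blockPaths k i j,
      (w : List V).get ∈ allowedBlocks 𝒢.shiftSpace (w : List V).length := by
    rintro ⟨w, hw⟩
    obtain ⟨y, hy, h⟩ := exists_mem_blockWords_extending hw hf0 hf hg0 hg
    exact mem_allowedBlocks_iff.2 ⟨y, hy, 0, fun i => by rw [zero_add, h]⟩
  let φ : 𝒢.blockPaths k i j → Σ n, allowedBlocks 𝒢.shiftSpace n := fun w => ⟨_, _, hmem w⟩
  have hinj : Function.Injective φ := by
    refine Function.Injective.of_comp (f := fun c : Σ n, allowedBlocks 𝒢.shiftSpace n =>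
      List.ofFn (c.2 : Fin c.1 → V)) fun w v h => Subtype.ext ?_
    simpa [φ, List.ofFn_get] using h
  rw [genMatrixENNReal_pow_apply]
  refine (ENNReal.tsum_comp_le_tsum_of_injective hinj fun c => x ^ c.1).trans_eq ?_
  rw [ENNReal.tsum_sigma']
  refine tsum_congr fun n => ?_
  simp only
  rw [ENNReal.tsum_set_const, ← (Set.toFinite _).cast_ncard_eq, ENat.toENNReal_coe]

end SetEquippedGraph

/-! ### Estimates for generating functions -/

section GenFun

variable {S T : Set ℕ} {x y : ℝ}

instance finite_inter_Iic (S : Set ℕ) (N : ℕ) : Finite ↥(S ∩ Set.Iic N) :=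
  ((Set.finite_Iic N).inter_of_right S).to_subtype

theorem genFun_nonneg (hx : 0 ≤ x) : 0 ≤ genFun S x :=
  tsum_nonneg fun _ => pow_nonneg hx _

theorem ofReal_genFun (hx : 0 ≤ x) (hS : Summable fun s : S => x ^ (s : ℕ)) :
    ENNReal.ofReal (genFun S x) = ∑' s : S, ENNReal.ofReal x ^ (s : ℕ) := by
  rw [genFun, ENNReal.ofReal_tsum_of_nonneg (fun _ => pow_nonneg hx _) hS]
  simp only [ENNReal.ofReal_pow hx]

theorem genFun_mono_set (hx : 0 ≤ x) (hTS : T ⊆ S) (hS : Summable fun s : S => x ^ (s : ℕ)) :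
    genFun T x ≤ genFun S x := by
  have hT : Summable fun s : T => x ^ (s : ℕ) :=
    hS.comp_injective (Set.inclusion_injective hTS)
  refine (ENNReal.ofReal_le_ofReal_iff (genFun_nonneg hx)).1 ?_
  rw [ofReal_genFun hx hS, ofReal_genFun hx hT]
  exact ENNReal.tsum_mono_subtype (fun s => ENNReal.ofReal x ^ s) hTS

/-- Every exponent is at least 1, so one factor `x / y` can be split off from each term. -/
theorem genFun_le_div_mul (hS : ∀ s ∈ S, 0 < s) (hx : 0 < x) (hxy : x ≤ y)
    (hy : Summable fun s : S => y ^ (s : ℕ)) : genFun S x ≤ x / y * genFun S y := by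
  have hy0 : 0 < y := hx.trans_le hxy
  have hle : ∀ s : S, x ^ (s : ℕ) ≤ x / y * y ^ (s : ℕ) := fun s => by
    obtain ⟨m, hm⟩ := Nat.exists_eq_succ_of_ne_zero (hS s s.2).ne'
    rw [hm, pow_succ, pow_succ]
    calc x ^ m * x ≤ y ^ m * x := by gcongr
      _ = _ := by field_simp
  rw [genFun, genFun, ← tsum_mul_left]
  exact Summable.tsum_le_tsum hle
    (Summable.of_nonneg_of_le (fun _ => pow_nonneg hx.le _) hle (hy.mul_left _)) (hy.mul_left _)

theorem genFun_le_pow_mul {N : ℕ} (hx : 0 < x) (hxy : x ≤ y) :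
    genFun (S ∩ Set.Iic N) y ≤ (y / x) ^ N * genFun (S ∩ Set.Iic N) x := by
  rw [genFun, genFun, ← tsum_mul_left]
  refine Summable.tsum_le_tsum (fun s => ?_) .of_finite .of_finite
  have h1 : 1 ≤ y / x := (one_le_div hx).2 hxy
  calc y ^ (s : ℕ) = (y / x) ^ (s : ℕ) * x ^ (s : ℕ) := by rw [div_pow]; field_simp
    _ ≤ _ := by gcongr; exact s.2.2

theorem genFun_pos (hS : S.Nonempty) (hx : 0 < x) (hs : Summable fun s : S => x ^ (s : ℕ)) :
    0 < genFun S x := by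
  obtain ⟨s, hsS⟩ := hS
  exact hs.tsum_pos (fun _ => pow_nonneg hx.le _) ⟨s, hsS⟩ (pow_pos hx _)

theorem summable_of_lt_one (S : Set ℕ) (hx : 0 ≤ x) (hx1 : x < 1) :
    Summable fun s : S => x ^ (s : ℕ) :=
  (summable_geometric_of_lt_one hx hx1).subtype S

/-- Some finite partial sum exceeds `genFun S x / c`, the sum being positive. -/
theorem eventually_genFun_le_mul (hne : S.Nonempty) (hx : 0 < x)
    (hs : Summable fun s : S => x ^ (s : ℕ)) {c : ℝ} (hc : 1 < c) :
    ∀ᶠ N in atTop, genFun S x ≤ c * genFun (S ∩ Set.Iic N) x := by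
  have hpos := genFun_pos hne hx hs
  have hlt : genFun S x / c < genFun S x := div_lt_self hpos hc
  obtain ⟨F, hF⟩ := (hs.hasSum.eventually_const_lt hlt).exists
  filter_upwards [eventually_ge_atTop (F.sup fun s => (s : ℕ))] with N hN
  have h1 : ∑ s ∈ F, x ^ (s : ℕ) ≤ genFun (S ∩ Set.Iic N) x := by
    have h2 : genFun (Subtype.val '' (F : Set S)) x = ∑ s ∈ F, x ^ (s : ℕ) := by
      rw [genFun, tsum_image (fun s : ℕ => x ^ s) Subtype.val_injective.injOn,
        ← Finset.tsum_subtype]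
      rfl
    rw [← h2]
    refine genFun_mono_set hx.le ?_ .of_finite
    rintro _ ⟨s, hsF, rfl⟩
    exact ⟨s.2, (Finset.le_sup (f := fun s : S => (s : ℕ)) hsF).trans hN⟩
  rw [← div_le_iff₀' (by linarith)]
  exact hF.le.trans h1

theorem continuousAt_genFun (S : Set ℕ) (hx : 0 < x) (hx1 : x < 1) :
    ContinuousAt (genFun S) x := by
  have h : ContinuousOn (genFun S) (Set.Icc 0 ((x + 1) / 2)) := by
    refine continuousOn_tsum (u := fun s : S => ((x + 1) / 2) ^ (s : ℕ))
      (fun s => (continuous_pow _).continuousOn)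
      (summable_of_lt_one S (by linarith) (by linarith)) fun s y hy => ?_
    rw [norm_pow, Real.norm_of_nonneg hy.1]
    exact pow_le_pow_left₀ hy.1 hy.2 _
  exact h.continuousAt (Icc_mem_nhds hx (by linarith))

end GenFun

/-! ### Convergence of the word series and matrix comparisons -/

theorem ENNReal.le_of_forall_one_lt_le_ofReal_mul {a b : ℝ≥0∞}
    (h : ∀ c : ℝ, 1 < c → a ≤ ENNReal.ofReal c * b) : a ≤ b := by
  have h1 : Tendsto (fun c : ℝ => ENNReal.ofReal c * b) (𝓝[>] 1) (𝓝 (ENNReal.ofReal 1 * b)) :=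
    ENNReal.Tendsto.mul_const
      ((ENNReal.continuous_ofReal.tendsto 1).mono_left nhdsWithin_le_nhds)
      (Or.inl (by simp))
  rw [ENNReal.ofReal_one, one_mul] at h1
  exact ge_of_tendsto h1 (eventually_mem_nhdsWithin.mono h)

theorem tsum_ncard_allowedBlocks_ne_top {A : Type*} [TopologicalSpace A]
    {X : SymbolicDynamics.FullShift.Subshift A ℤ} {h x : ℝ} (hh : HasEntropy X h) (hx : 0 < x)
    (hxh : x < Real.exp (-h)) :
    ∑' n : ℕ, ((allowedBlocks X n).ncard : ℝ≥0∞) * ENNReal.ofReal x ^ n ≠ ∞ := by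
  have hlog : Real.log x < -h := (Real.log_lt_iff_lt_exp hx).2 hxh
  -- With `h < h' < -log x`, the terms are eventually at most `(x * exp h') ^ n`, of ratio below 1.
  obtain ⟨h', h1, h2⟩ := exists_between (lt_neg_of_lt_neg hlog)
  have hlt : x * Real.exp h' < 1 := by
    rw [← Real.exp_log hx, ← Real.exp_add, Real.exp_lt_one_iff]
    linarith
  have hs : Summable fun n : ℕ => ((allowedBlocks X n).ncard : ℝ) * x ^ n := by
    refine summable_of_isBigO_nat (summable_geometric_of_lt_one (by positivity) hlt)
      (Asymptotics.IsBigO.of_bound 1 ?_)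
    filter_upwards [hh.eventually_lt_const h1, eventually_ne_atTop 0] with n hn hn0
    have hn' : (0 : ℝ) < n := by exact_mod_cast Nat.pos_of_ne_zero hn0
    have h3 : ((allowedBlocks X n).ncard : ℝ) ≤ Real.exp h' ^ n := by
      rcases (Nat.cast_nonneg (α := ℝ) (allowedBlocks X n).ncard).eq_or_lt with h0 | h0
      · rw [← h0]; positivity
      · rw [← Real.exp_nat_mul, ← Real.log_le_iff_le_exp h0]
        rw [one_div_mul_eq_div, div_lt_iff₀' hn'] at hn
        exact hn.le
    rw [Real.norm_of_nonneg (by positivity), Real.norm_of_nonneg (by positivity), one_mul, mul_pow,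
      mul_comm]
    gcongr
  convert hs.tsum_ofReal_ne_top using 3 with n
  rw [ENNReal.ofReal_mul (Nat.cast_nonneg _), ENNReal.ofReal_natCast, ENNReal.ofReal_pow hx.le]

theorem genMatrix_nonneg {V : Type*} (G : Digraph V) (S : V → Set ℕ) {x : ℝ} (hx : 0 ≤ x) (i j : V) :
    0 ≤ genMatrix G S x i j := by
  simp only [genMatrix, Matrix.of_apply]
  split_ifs
  · exact genFun_nonneg hx
  · exact le_rfl

theorem genMatrix_le_mul {V : Type*} {G : Digraph V} {S T : V → Set ℕ} {x y c : ℝ}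
    (h : ∀ v, genFun (S v) x ≤ c * genFun (T v) y) (i j : V) :
    genMatrix G S x i j ≤ c * genMatrix G T y i j := by
  simp only [genMatrix, Matrix.of_apply]
  split_ifs
  · exact h i
  · simp

section Matrix

variable {V : Type*} [Fintype V] [DecidableEq V]

theorem hasWalk_of_pow_apply_ne_zero {R : Type*} [Semiring R] {A : Matrix V V R}
    {r : V → V → Prop} (hA : ∀ i j, A i j ≠ 0 → r i j) {k : ℕ} {i j : V} (h : (A ^ k) i j ≠ 0) :
    HasWalk r k i := by
  induction k generalizing i with
  | zero => trivial
  | succ k ih =>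
    rw [pow_succ', Matrix.mul_apply] at h
    obtain ⟨a, -, ha⟩ := Finset.exists_ne_zero_of_sum_ne_zero h
    exact ⟨a, hA _ _ (left_ne_zero_of_mul ha), ih (right_ne_zero_of_mul ha)⟩

theorem hasWalk_flip_of_pow_apply_ne_zero {R : Type*} [CommSemiring R] {A : Matrix V V R}
    {r : V → V → Prop} (hA : ∀ i j, A i j ≠ 0 → r i j) {k : ℕ} {i j : V} (h : (A ^ k) i j ≠ 0) :
    HasWalk (flip r) k j := by
  refine hasWalk_of_pow_apply_ne_zero (A := A.transpose) (j := i) (fun i j => hA j i) ?_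
  rwa [← Matrix.transpose_pow]

theorem ofReal_pow_apply_le {M : Matrix V V ℝ} {E : Matrix V V ℝ≥0∞} (hM : ∀ i j, 0 ≤ M i j)
    (h : ∀ i j, ENNReal.ofReal (M i j) ≤ E i j) (k : ℕ) (i j : V) :
    ENNReal.ofReal ((M ^ k) i j) ≤ (E ^ k) i j := by
  induction k generalizing j with
  | zero => rw [pow_zero, pow_zero, Matrix.one_apply, Matrix.one_apply]; split_ifs <;> simp
  | succ k ih =>
    rw [pow_succ, pow_succ, Matrix.mul_apply, Matrix.mul_apply, ENNReal.ofReal_sum_of_nonneg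
      fun a _ => mul_nonneg (Matrix.pow_apply_nonneg hM k i a) (hM a j)]
    refine Finset.sum_le_sum fun a _ => ?_
    rw [ENNReal.ofReal_mul (Matrix.pow_apply_nonneg hM k i a)]
    exact mul_le_mul' (ih a) (h a j)

theorem pow_apply_eq_ofReal {M : Matrix V V ℝ} {E : Matrix V V ℝ≥0∞} (hM : ∀ i j, 0 ≤ M i j)
    (h : ∀ i j, E i j = ENNReal.ofReal (M i j)) (k : ℕ) (i j : V) :
    (E ^ k) i j = ENNReal.ofReal ((M ^ k) i j) := by
  induction k generalizing j with
  | zero => rw [pow_zero, pow_zero, Matrix.one_apply, Matrix.one_apply]; split_ifs <;> simp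
  | succ k ih =>
    rw [pow_succ, pow_succ, Matrix.mul_apply, Matrix.mul_apply, ENNReal.ofReal_sum_of_nonneg
      fun a _ => mul_nonneg (Matrix.pow_apply_nonneg hM k i a) (hM a j)]
    refine Finset.sum_congr rfl fun a _ => ?_
    rw [ENNReal.ofReal_mul (Matrix.pow_apply_nonneg hM k i a), ih, h]

end Matrix

/-! ### The function `rho` and its value at `exp (-h)` -/

namespace SetEquippedGraph

variable {V : Type*} [Fintype V] [DecidableEq V] {𝒢 : SetEquippedGraph V}

/-- The spectral radius of the generating matrix of the sets `S_v ∩ [0, N]`. -/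
noncomputable def truncRho (𝒢 : SetEquippedGraph V) (N : ℕ) (x : ℝ) : ℝ≥0∞ :=
  matrixSpectralRadius (genMatrix 𝒢.toDigraph (fun v => 𝒢.S v ∩ Set.Iic N) x)

/-- Both branches of `rho` become one: when the series converge, a large truncation recovers `B(x)`
up to any factor `c > 1`. -/
theorem rho_eq_iSup_truncRho {x : ℝ} (hx : 0 < x) : 𝒢.rho x = ⨆ N, 𝒢.truncRho N x := by
  unfold rho
  split_ifs with h
  · apply le_antisymm
    · refine ENNReal.le_of_forall_one_lt_le_ofReal_mul fun c hc => ?_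
      obtain ⟨N, hN⟩ := (eventually_all.2 fun v =>
        eventually_genFun_le_mul (𝒢.S_nonempty v) hx (h v) hc).exists
      refine (matrixSpectralRadius_le_mul (zero_le_one.trans hc.le) (genMatrix_nonneg _ _ hx.le)
        (genMatrix_le_mul hN)).trans ?_
      gcongr
      exact le_iSup (fun N => 𝒢.truncRho N x) N
    · refine iSup_le fun N => ?_
      have := matrixSpectralRadius_le_mul zero_le_one
        (genMatrix_nonneg 𝒢.toDigraph (fun v => 𝒢.S v ∩ Set.Iic N) hx.le)
        (genMatrix_le_mul (T := 𝒢.S) (y := x) fun v => (one_mul (genFun (𝒢.S v) x)).symm ▸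
          genFun_mono_set hx.le Set.inter_subset_left (h v))
      rwa [ENNReal.ofReal_one, one_mul] at this
  · rfl

theorem rho_le_div_mul {x y : ℝ} (hx : 0 < x) (hxy : x ≤ y) :
    𝒢.rho x ≤ ENNReal.ofReal (x / y) * 𝒢.rho y := by
  have hy := hx.trans_le hxy
  rw [rho_eq_iSup_truncRho hx, rho_eq_iSup_truncRho hy]
  refine iSup_le fun N => ?_
  refine (matrixSpectralRadius_le_mul (div_nonneg hx.le hy.le) (genMatrix_nonneg _ _ hx.le)
    (genMatrix_le_mul fun v => genFun_le_div_mul (fun s hs => 𝒢.S_pos v s hs.1) hx hxy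
      .of_finite)).trans ?_
  gcongr
  exact le_iSup (fun N => 𝒢.truncRho N y) N

theorem truncRho_le_pow_mul {x y : ℝ} (N : ℕ) (hx : 0 < x) (hxy : x ≤ y) :
    𝒢.truncRho N y ≤ ENNReal.ofReal ((y / x) ^ N) * 𝒢.truncRho N x :=
  matrixSpectralRadius_le_mul (pow_nonneg (div_nonneg (hx.trans_le hxy).le hx.le) N)
    (genMatrix_nonneg _ _ (hx.trans_le hxy).le) (genMatrix_le_mul fun _ => genFun_le_pow_mul hx hxy)

theorem eq_of_rho_eq_one {x y : ℝ} (hx : 0 < x) (hy : 0 < y) (h : 𝒢.rho x = 1)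
    (h' : 𝒢.rho y = 1) : x = y := by
  have key : ∀ {x y : ℝ}, 0 < x → 𝒢.rho x = 1 → 𝒢.rho y = 1 → ¬ x < y := by
    intro x y hx h h' hlt
    have := rho_le_div_mul (𝒢 := 𝒢) hx hlt.le
    rw [h, h', mul_one, ENNReal.one_le_ofReal, one_le_div (hx.trans hlt)] at this
    exact absurd hlt (not_lt.2 this)
  exact le_antisymm (not_lt.1 (key hy h' h)) (not_lt.1 (key hx h h'))

/-- For `N` so large that no truncated set is empty, every edge has weight at least 1, and a
bi-infinite path supplies walks of all lengths. -/
theorem one_le_rho_one (hB : 𝒢.blockWords.Nonempty) : 1 ≤ 𝒢.rho 1 := by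
  obtain ⟨x, u, n, t, hn, hu, -⟩ := hB
  choose s hs using 𝒢.S_nonempty
  obtain ⟨N, hN⟩ := (Set.finite_range s).bddAbove
  let M := genMatrix 𝒢.toDigraph (fun v => 𝒢.S v ∩ Set.Iic N) 1
  have hM0 : ∀ i j, 0 ≤ M i j := genMatrix_nonneg _ _ zero_le_one
  have hM : ∀ i j, 𝒢.Adj i j → 1 ≤ M i j := by
    intro i j hij
    simp only [M, genMatrix, Matrix.of_apply, if_pos hij]
    have := Summable.le_tsum (f := fun s : ↥(𝒢.S i ∩ Set.Iic N) => (1 : ℝ) ^ (s : ℕ))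
      (L := SummationFilter.unconditional _) .of_finite
      ⟨s i, hs i, hN ⟨i, rfl⟩⟩ fun _ _ => by simp
    simpa only [one_pow, genFun] using this
  have hpow : ∀ k : ℕ, 1 ≤ (M ^ k) (u 0) (u k) := by
    intro k
    induction k with
    | zero => simp
    | succ k ih =>
      rw [pow_succ, Matrix.mul_apply]
      refine le_trans ?_ (Finset.single_le_sum (fun a _ => mul_nonneg
        (Matrix.pow_apply_nonneg hM0 k _ a) (hM0 a _)) (Finset.mem_univ (u k)))
      push_cast
      exact one_le_mul_of_one_le_of_one_le ih (hM _ _ (hu k))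
  rw [rho_eq_iSup_truncRho one_pos]
  exact (one_le_matrixSpectralRadius fun k => ⟨_, _, hpow k⟩).trans
    (le_iSup (fun N => 𝒢.truncRho N 1) N)

variable [TopologicalSpace V] [DiscreteTopology V]

/-- Only vertices with rays in the right direction are controlled by the word series. Splitting off
`e` initial and `d` final steps of a walk ensures this for the middle part: nonzero entries of `M ^
e` and `M ^ d` force the rays. -/
theorem truncRho_le_one {x : ℝ} (hx : 0 < x)
    (hsum : ∑' n : ℕ, ((allowedBlocks 𝒢.shiftSpace n).ncard : ℝ≥0∞) * ENNReal.ofReal x ^ n ≠ ∞)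
    (N : ℕ) : 𝒢.truncRho N x ≤ 1 := by
  set C := ∑' n : ℕ, ((allowedBlocks 𝒢.shiftSpace n).ncard : ℝ≥0∞) * ENNReal.ofReal x ^ n
  set M := genMatrix 𝒢.toDigraph (fun v => 𝒢.S v ∩ Set.Iic N) x with hMdef
  have hM0 : ∀ i j, 0 ≤ M i j := genMatrix_nonneg _ _ hx.le
  have hadj : ∀ i j, M i j ≠ 0 → 𝒢.Adj i j := by
    intro i j h
    by_contra hij
    simp [hMdef, genMatrix, hij] at h
  have hME : ∀ i j, ENNReal.ofReal (M i j) ≤ 𝒢.genMatrixENNReal (ENNReal.ofReal x) i j := by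
    intro i j
    simp only [hMdef, genMatrix, genMatrixENNReal, Matrix.of_apply]
    split_ifs
    · rw [ofReal_genFun hx.le .of_finite]
      exact ENNReal.tsum_mono_subtype (fun s => ENNReal.ofReal x ^ s) Set.inter_subset_left
    · simp
  obtain ⟨d, hd⟩ := exists_length_forcing_ray 𝒢.Adj
  obtain ⟨e, he⟩ := exists_length_forcing_ray (flip 𝒢.Adj)
  have hmid : ∀ k i a b j, (M ^ e) i a * (M ^ k) a b * (M ^ d) b j ≤
      (M ^ e) i a * C.toReal * (M ^ d) b j := by
    intro k i a b j
    by_cases ha : (M ^ e) i a = 0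
    · simp [ha]
    by_cases hb : (M ^ d) b j = 0
    · simp [hb]
    obtain ⟨g, hg0, hg⟩ := he a (hasWalk_flip_of_pow_apply_ne_zero hadj ha)
    obtain ⟨f, hf0, hf⟩ := hd b (hasWalk_of_pow_apply_ne_zero hadj hb)
    have h1 : (M ^ k) a b ≤ C.toReal :=
      (ENNReal.ofReal_le_iff_le_toReal hsum).1 ((ofReal_pow_apply_le hM0 hME k a b).trans
        (genMatrixENNReal_pow_apply_le _ k hf0 hf hg0 hg))
    have := Matrix.pow_apply_nonneg hM0 e i a
    have := Matrix.pow_apply_nonneg hM0 d b j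
    gcongr
  let K : V → V → ℝ := fun i j => ∑ b, ∑ a, (M ^ e) i a * C.toReal * (M ^ d) b j
  have hK0 : ∀ i j, 0 ≤ K i j := fun i j => Finset.sum_nonneg fun b _ =>
    Finset.sum_nonneg fun a _ => mul_nonneg (mul_nonneg (Matrix.pow_apply_nonneg hM0 e i a)
      ENNReal.toReal_nonneg) (Matrix.pow_apply_nonneg hM0 d b j)
  refine matrixSpectralRadius_le_one (K := ∑ i, ∑ j, K i j) (d := e + d) hM0 fun k i j => ?_
  calc (M ^ (k + (e + d))) i j = ∑ b, ∑ a, (M ^ e) i a * (M ^ k) a b * (M ^ d) b j := by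
        rw [show k + (e + d) = e + k + d by ring, pow_add, pow_add, Matrix.mul_apply]
        simp only [Matrix.mul_apply, Finset.sum_mul]
    _ ≤ K i j := Finset.sum_le_sum fun b _ => Finset.sum_le_sum fun a _ => hmid k i a b j
    _ ≤ ∑ j, K i j := Finset.single_le_sum (fun j _ => hK0 i j) (Finset.mem_univ j)
    _ ≤ _ := Finset.single_le_sum (f := fun i => ∑ j, K i j)
        (fun i _ => Finset.sum_nonneg fun j _ => hK0 i j) (Finset.mem_univ i)

theorem exp_mul_le_one {h x : ℝ}
    (hle : ∀ n : ℕ, Real.exp h ^ n ≤ ((allowedBlocks 𝒢.shiftSpace n).ncard : ℝ)) (hx : 0 < x)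
    (hx1 : x < 1) (hrho : matrixSpectralRadius (genMatrix 𝒢.toDigraph 𝒢.S x) < 1) :
    Real.exp h * x ≤ 1 := by
  by_contra! hb
  set b := Real.exp h * x
  set D := ∑ i, ∑ j, ∑' k : ℕ, (𝒢.genMatrixENNReal (ENNReal.ofReal x) ^ k) i j
  have hD : D ≠ ∞ := by
    refine ENNReal.sum_ne_top.2 fun i _ => ENNReal.sum_ne_top.2 fun j _ => ?_
    have heq : ∀ i j, 𝒢.genMatrixENNReal (ENNReal.ofReal x) i j =
        ENNReal.ofReal (genMatrix 𝒢.toDigraph 𝒢.S x i j) := by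
      intro i j
      simp only [genMatrix, genMatrixENNReal, Matrix.of_apply]
      split_ifs
      · exact (ofReal_genFun hx.le (summable_of_lt_one _ hx.le hx1)).symm
      · simp
    simp only [pow_apply_eq_ofReal (genMatrix_nonneg _ _ hx.le) heq]
    exact tsum_pow_ne_top_of_matrixSpectralRadius_lt_one hrho i j
  have hbound : ∀ n : ℕ, b ^ n ≤ ((n + 1) * Fintype.card V) ^ 2 * D.toReal := by
    intro n
    have h1 := ncard_allowedBlocks_mul_pow_le (𝒢 := 𝒢)
      (ENNReal.ofReal_le_one.2 hx1.le) n
    have h2 := ENNReal.toReal_mono (ENNReal.mul_ne_top (ENNReal.natCast_ne_top _) hD) h1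
    simp only [ENNReal.toReal_mul, ENNReal.toReal_natCast, ENNReal.toReal_pow,
      ENNReal.toReal_ofReal hx.le] at h2
    rw [mul_pow]
    refine (mul_le_mul_of_nonneg_right (hle n) (by positivity)).trans (h2.trans_eq ?_)
    push_cast
    rfl
  -- The shift to `n + 1` matches the polynomial factor in `hbound`; the extra `b` compensates in
  -- the denominator.
  have hlim : Tendsto (fun n : ℕ => ((n + 1 : ℕ) : ℝ) ^ 2 / b ^ (n + 1) *
      (b * (Fintype.card V ^ 2 * D.toReal))) atTop (𝓝 0) := by
    have := ((tendsto_pow_const_div_const_pow_of_one_lt 2 hb).comp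
      (tendsto_add_atTop_nat 1)).mul_const (b * (Fintype.card V ^ 2 * D.toReal))
    simpa using this
  obtain ⟨n, hn⟩ := (hlim.eventually_lt_const one_pos).exists
  have hb0 : 0 < b := zero_lt_one.trans hb
  rw [div_mul_eq_mul_div, div_lt_one (by positivity), pow_succ b] at hn
  have h3 := hbound n
  push_cast at hn
  have h4 : b ^ n * b ≤ ((n + 1) * Fintype.card V) ^ 2 * D.toReal * b := by gcongr
  nlinarith

theorem rho_exp_neg_entropy {h : ℝ} (hB : 𝒢.blockWords.Nonempty) (h0 : 0 ≤ h)
    (hh : HasEntropy 𝒢.shiftSpace h)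
    (hle : ∀ n : ℕ, Real.exp h ^ n ≤ ((allowedBlocks 𝒢.shiftSpace n).ncard : ℝ)) :
    𝒢.rho (Real.exp (-h)) = 1 := by
  set r := Real.exp (-h) with hr
  have hr0 : 0 < r := Real.exp_pos _
  have hr1 : r ≤ 1 := Real.exp_le_one_iff.2 (by linarith)
  apply le_antisymm
  · rw [rho_eq_iSup_truncRho hr0]
    refine iSup_le fun N => ?_
    -- The word series may diverge at `r` itself. The bound is taken at `r / c`, moved to `r` at the
    -- price `c ^ N` with `N` fixed, and then `c` tends to 1.
    have hlim : Tendsto (fun c : ℝ => ENNReal.ofReal (c ^ N)) (𝓝[>] 1) (𝓝 1) := by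
      have h1 : Continuous fun c : ℝ => ENNReal.ofReal (c ^ N) :=
        ENNReal.continuous_ofReal.comp (continuous_pow N)
      simpa using (h1.tendsto 1).mono_left nhdsWithin_le_nhds
    refine ge_of_tendsto hlim (eventually_mem_nhdsWithin.mono fun c hc => ?_)
    have hc : 1 < c := hc
    have hrc : r / c < r := div_lt_self hr0 hc
    have hrc0 : 0 < r / c := by positivity
    refine (truncRho_le_pow_mul N hrc0 hrc.le).trans ?_
    rw [div_div_cancel₀ hr0.ne']
    exact mul_le_of_le_one_right' (truncRho_le_one hrc0
      (tsum_ncard_allowedBlocks_ne_top hh hrc0 hrc) N)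
  -- At `r = 1` the generating functions may diverge, so continuity is used only for `r < 1`.
  · rcases hr1.eq_or_lt with h1 | h1
    · rw [h1]; exact one_le_rho_one hB
    by_contra! hlt
    have hS : ∀ v, Summable fun s : 𝒢.S v => r ^ (s : ℕ) :=
      fun v => summable_of_lt_one _ hr0.le h1
    rw [rho, if_pos hS] at hlt
    set a := matrixSpectralRadius (genMatrix 𝒢.toDigraph 𝒢.S r)
    -- The slack `c` absorbs the growth of the generating functions from `r` to a nearby `y > r`,
    -- keeping the radius at `y` below 1.
    obtain ⟨c, hc, hca⟩ : ∃ c : ℝ, 1 < c ∧ ENNReal.ofReal c * a < 1 := by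
      by_contra! hcon
      exact absurd (ENNReal.le_of_forall_one_lt_le_ofReal_mul hcon) (not_le.2 hlt)
    have hev : ∀ᶠ y in 𝓝[>] r, ∀ v, genFun (𝒢.S v) y < c * genFun (𝒢.S v) r :=
      eventually_all.2 fun v =>
        ((continuousAt_genFun (𝒢.S v) hr0 h1).mono_left nhdsWithin_le_nhds).eventually_lt_const
          (lt_mul_of_one_lt_left (genFun_pos (𝒢.S_nonempty v) hr0 (hS v)) hc)
    obtain ⟨y, hy, hry, hy1⟩ := (hev.and (Ioo_mem_nhdsGT h1)).exists
    have hy0 := hr0.trans hry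
    have h2 := exp_mul_le_one hle hy0 hy1 ((matrixSpectralRadius_le_mul (zero_le_one.trans hc.le)
      (genMatrix_nonneg _ _ hy0.le) (genMatrix_le_mul fun v => (hy v).le)).trans_lt hca)
    have h3 : Real.exp h * r < Real.exp h * y := by gcongr
    rw [hr, ← Real.exp_add, add_neg_cancel, Real.exp_zero] at h3
    exact absurd h2 (not_le.2 h3)

end SetEquippedGraph

theorem theorem1p2 {V : Type*} [Fintype V] [DecidableEq V]
    [TopologicalSpace V] [DiscreteTopology V] (𝒢 : SetEquippedGraph V)
    (hX : 𝒢.shiftSpace.carrier.Nonempty) :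
    ∃ l : ℝ, (0 < l ∧ 𝒢.rho l = 1) ∧ (∀ x : ℝ, 0 < x → 𝒢.rho x = 1 → x = l) ∧
      HasEntropy 𝒢.shiftSpace (Real.log l⁻¹) := by
  obtain ⟨h, h0, hh, hle⟩ := exists_hasEntropy 𝒢.shiftSpace hX
  have hrho := SetEquippedGraph.rho_exp_neg_entropy (closure_nonempty_iff.1 hX) h0 hh hle
  refine ⟨Real.exp (-h), ⟨Real.exp_pos _, hrho⟩, fun x hx hx1 =>
    SetEquippedGraph.eq_of_rho_eq_one hx (Real.exp_pos _) hx1 hrho, ?_⟩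
  rwa [← Real.exp_neg, neg_neg, Real.log_exp]
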